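/- Let $n,n'\ge 1$ and $d\ge 0$ be integers, let $M_{n,d}$ be the set of multiindices $\alpha\in\mathbb{Z}_{\ge 0}^n$ with $\alpha_1+\dots+\alpha_n\le d$, and let $\mathcal A\subset M_{n,d}\times\{1,\dots,n'\}$. Put $\mathcal A_k=\{\alpha : (\alpha,k)\in\mathcal A\}$. Suppose that $\mathcal A$ is admissible, i.e. 1. (dimensionality) there is an integer $\#\mathcal A$ with $\operatorname{card}\mathcal A_k=\#\mathcal A$ for all $k=1,\dots,n'$; 2. (scaling) there is an integer $|\mathcal A|$ with $\sum_{k=1}^{n'}\sum_{\alpha\in\mathcal A_k}\alpha=|\mathcal A|\,(1,\dots,1)$; 3. (spanning) the multiindices in $\bigcup_k\mathcal A_k$ span $\mathbb R^n$ as vectors; 4. (nondegeneracy) $(0,\dots,0)\in\mathcal A_k$ for all $k$. Let $\alpha_{1,k}<\dots<\alpha_{\#\mathcal A,k}$ be the enumeration of $\mathcal A_k$ in increasing dictionary order ($\alpha<\beta$ if $\alpha_i<\beta_i$ at the smallest index $i$ with $\alpha_i\ne\beta_i$), and let $\beta_m=\sum_{k=1}^{n'}\alpha_{m,k}$. Suppose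 also that $\mathcal A$ satisfies the strengthened spanning condition: $\beta_1,\dots,\beta_{\#\mathcal A}$ span $\mathbb R^n$. For $x=(x_1,\dots,x_{\#\mathcal A})\in(\mathbb R^n)^{\#\mathcal A}$ let $$V_{\mathcal A}(x)=\prod_{k=1}^{n'}\det\bigl(x_j^{\alpha_{m,k}}\bigr)_{j,m=1}^{\#\mathcal A}$$ be the Vandermonde polynomial of $\mathcal A$, where $y^\alpha=\prod_i y_i^{\alpha_i}$. Then $p:=\frac{\#\mathcal A}{\#\mathcal A+|\mathcal A|}<1$, and there is a constant $c>0$ such that $$\int_{(\mathbb R^n)^{\#\mathcal A}}|V_{\mathcal A}(x)|\prod_{j=1}^{\#\mathcal A}|f_j(x_j)|\,dx_1\cdots dx_{\#\mathcal A}\;\ge\; c\prod_{j=1}^{\#\mathcal A}\|f_j\|_{L^p(\mathbb R^n)}$$ for all Lebesgue measurable functions $f_1,\dots,f_{\#\mathcal A}:\mathbb R^n\to\mathbb C$. Both sides take values in $[0,\infty]$, with $0\cdot\infty=0$. -/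

import Mathlib

open MeasureTheory

namespace VandermondeMeans

/-- The multiindices of length `n` and degree at most `d`. -/
def multiindices (n d : ℕ) : Set (Fin n → ℕ) := {α | ∑ i, α i ≤ d}

/-- The collection `𝒜_k` of the multiindices `α` with `(α, k) ∈ 𝒜`. It is kept in the type synonym
`Lex (Fin n → ℕ)`, which is linearly ordered by the dictionary order: `α < β` when `α i < β i` at
the smallest index `i` at which `α` and `β` differ. -/
noncomputable def slice {n n' : ℕ} (A : Finset ((Fin n → ℕ) × Fin n')) (k : Fin n') :
    Finset (Lex (Fin n → ℕ)) :=
  (A.filter fun a => a.2 = k).image fun a => toLex a.1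

/-- Admissibility of `𝒜` with `#𝒜 = N` and `|𝒜| = s`, here with the plain form of the spanning
condition; the strengthened form is `StrongSpanning`. -/
structure Admissible {n n' : ℕ} (A : Finset ((Fin n → ℕ) × Fin n')) (N s : ℕ) : Prop where
  dimensionality : ∀ k, (slice A k).card = N
  scaling : ∀ i, ∑ k, ∑ α ∈ slice A k, ofLex α i = s
  spanning : Submodule.span ℝ
    {v : Fin n → ℝ | ∃ k, ∃ α ∈ slice A k, v = fun i => (ofLex α i : ℝ)} = ⊤
  nondegeneracy : ∀ k, toLex (0 : Fin n → ℕ) ∈ slice A k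

section

variable {n n' N : ℕ} {A : Finset ((Fin n → ℕ) × Fin n')} (h : ∀ k, (slice A k).card = N)

/-- The increasing enumeration `α_{1,k} < ⋯ < α_{N,k}` of `𝒜_k` in the dictionary order. -/
noncomputable def enum (k : Fin n') (m : Fin N) : Fin n → ℕ :=
  ofLex ((slice A k).orderEmbOfFin (h k) m)

/-- `β_m = ∑_k α_{m,k}`. -/
noncomputable def beta (m : Fin N) : Fin n → ℕ := ∑ k, enum h k m

/-- The strengthened spanning condition: `β_1, …, β_N` span `ℝ^n`. -/
def StrongSpanning : Prop :=
  Submodule.span ℝ (Set.range fun (m : Fin N) (i : Fin n) => (beta h m i : ℝ)) = ⊤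

/-- The Vandermonde polynomial `V_𝒜(x) = ∏_k det (x_j ^ α_{m,k})_{j,m}` of points
`x_1, …, x_N` of `ℝ^n`, where `x ^ α = ∏_i (x i) ^ (α i)`. -/
noncomputable def vandermonde (x : Fin N → Fin n → ℝ) : ℝ :=
  ∏ k : Fin n', (Matrix.of fun j m : Fin N => ∏ i : Fin n, x j i ^ enum h k m i).det

end

end VandermondeMeans

namespace VandermondeMeans

open scoped ENNReal

/-! Write N for `#𝒜`, s for `|𝒜|`, and g_j for |f_j|. Fixing all points but the last, V_𝒜 is a
function of the last point with dictionary-order leading term x^β_N, whose coefficient is the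
analogous product of smaller determinants. Peeling off one point at a time gives ∫ |V_𝒜| ∏ g_j ≥ ∏
F_{j,j}, where F_{j,m} (`leadingInf`) is the infimum of ∫ |P| g_j over P with leading term x^β_m.
Since |V_𝒜| is symmetric in the points, the same integral bounds ∏ F_{j,σ(j)} for every permutation
σ (`prod_leadingInf_perm_le_lintegral`).

In the other direction, Hölder with w = ∑_m |P_m|/b_m bounds ‖g‖_p by a constant times ∑_m b_m⁻¹ ∫
|P_m| g, provided ∫ w^(-N/s) is bounded uniformly in the P_m and in weights b of product one
(`exists_lintegral_rpow_le`). Near a real part of a root, a polynomial is no smaller than its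
leading term recentred there, so every P_m can be replaced by a monomial (`lintegral_comp_abs_le`).
Scaling and strong spanning then make the monomial integral converge uniformly in b
(`exists_lintegral_sum_exp_rpow_le`).

The two halves meet through duality for the assignment problem (`exists_mul_assignment_dual`): there
are a, b and σ with F_{j,m} ≤ a_j b_m, ∏ b_m = 1 and ∏ a_j ≲ ∏ F_{j,σ(j)}. With this b, used for all
j at once, ‖g_j‖_p ≲ a_j, and multiplying over j finishes the proof. -/

/-! ### Leading terms in the dictionary order -/

/-- `P` is a polynomial in its first variable, whose leading coefficient is a polynomial in the
second variable, and so on, with `c * x ^ β` the resulting leading term in the dictionary order. -/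
def HasLeadingTerm : {n : ℕ} → (Fin n → ℕ) → ℝ → ((Fin n → ℝ) → ℝ) → Prop
  | 0, _, c, P => ∀ x, P x = c
  | _ + 1, β, c, P => Measurable P ∧ ∃ Q, HasLeadingTerm (Fin.tail β) c Q ∧
      ∀ y, ∃ p : Polynomial ℝ, p.natDegree ≤ β 0 ∧ p.coeff (β 0) = Q y ∧
        ∀ t : ℝ, P (Fin.cons t y) = p.eval t

namespace HasLeadingTerm

lemma measurable {n : ℕ} {β : Fin n → ℕ} {c : ℝ} {P : (Fin n → ℝ) → ℝ}
    (h : HasLeadingTerm β c P) : Measurable P := by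
  cases n with
  | zero =>
    have : P = fun _ => c := funext h
    rw [this]; exact measurable_const
  | succ n => exact h.1

lemma zero {n : ℕ} (β : Fin n → ℕ) : HasLeadingTerm β 0 (fun _ => 0) := by
  induction n with
  | zero => exact fun _ => rfl
  | succ n ih =>
    exact ⟨measurable_const, _, ih _, fun y => ⟨0, by simp, by simp, by simp⟩⟩

lemma one {n : ℕ} : HasLeadingTerm (0 : Fin n → ℕ) 1 (fun _ => 1) := by
  induction n with
  | zero => exact fun _ => rfl
  | succ n ih =>
    exact ⟨measurable_const, _, ih, fun y => ⟨1, by simp, by simp, by simp⟩⟩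

lemma add {n : ℕ} {β : Fin n → ℕ} {c c' : ℝ} {P P' : (Fin n → ℝ) → ℝ}
    (h : HasLeadingTerm β c P) (h' : HasLeadingTerm β c' P') :
    HasLeadingTerm β (c + c') (fun x => P x + P' x) := by
  induction n with
  | zero => intro x; beta_reduce; rw [h x, h' x]
  | succ n ih =>
    obtain ⟨hm, Q, hQ, hp⟩ := h
    obtain ⟨hm', Q', hQ', hp'⟩ := h'
    refine ⟨hm.add hm', _, ih hQ hQ', fun y => ?_⟩
    obtain ⟨p, h1, h2, h3⟩ := hp y
    obtain ⟨p', h1', h2', h3'⟩ := hp' y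
    refine ⟨p + p', Polynomial.natDegree_add_le_of_degree_le h1 h1', ?_, fun t => ?_⟩
    · rw [Polynomial.coeff_add, h2, h2']
    · beta_reduce; rw [h3, h3', Polynomial.eval_add]

lemma mul {n : ℕ} {β β' : Fin n → ℕ} {c c' : ℝ} {P P' : (Fin n → ℝ) → ℝ}
    (h : HasLeadingTerm β c P) (h' : HasLeadingTerm β' c' P') :
    HasLeadingTerm (β + β') (c * c') (fun x => P x * P' x) := by
  induction n with
  | zero => intro x; beta_reduce; rw [h x, h' x]
  | succ n ih =>
    obtain ⟨hm, Q, hQ, hp⟩ := h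
    obtain ⟨hm', Q', hQ', hp'⟩ := h'
    refine ⟨hm.mul hm', _, ih hQ hQ', fun y => ?_⟩
    obtain ⟨p, h1, h2, h3⟩ := hp y
    obtain ⟨p', h1', h2', h3'⟩ := hp' y
    refine ⟨p * p', Polynomial.natDegree_mul_le_of_le h1 h1', ?_, fun t => ?_⟩
    · rw [Pi.add_apply, Polynomial.coeff_mul_add_eq_of_natDegree_le h1 h1', h2, h2']
    · beta_reduce; rw [h3, h3', Polynomial.eval_mul]

lemma const_mul {n : ℕ} {β : Fin n → ℕ} {c : ℝ} {P : (Fin n → ℝ) → ℝ}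
    (h : HasLeadingTerm β c P) (a : ℝ) : HasLeadingTerm β (a * c) (fun x => a * P x) := by
  induction n with
  | zero => intro x; beta_reduce; rw [h x]
  | succ n ih =>
    obtain ⟨hm, Q, hQ, hp⟩ := h
    refine ⟨hm.const_mul a, _, ih hQ, fun y => ?_⟩
    obtain ⟨p, h1, h2, h3⟩ := hp y
    refine ⟨Polynomial.C a * p, (Polynomial.natDegree_C_mul_le a p).trans h1, ?_, fun t => ?_⟩
    · rw [Polynomial.coeff_C_mul, h2]
    · beta_reduce; rw [h3, Polynomial.eval_mul, Polynomial.eval_C]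

lemma sum {n : ℕ} {ι : Type*} (S : Finset ι) {β : Fin n → ℕ} {c : ι → ℝ}
    {P : ι → (Fin n → ℝ) → ℝ} (h : ∀ i ∈ S, HasLeadingTerm β (c i) (P i)) :
    HasLeadingTerm β (∑ i ∈ S, c i) (fun x => ∑ i ∈ S, P i x) := by
  classical
  induction S using Finset.induction_on with
  | empty => simpa using zero β
  | insert i S hi ih =>
    simp only [Finset.sum_insert hi]
    exact (h i (Finset.mem_insert_self _ _)).add
      (ih fun k hk => h k (Finset.mem_insert_of_mem hk))

lemma prod {n : ℕ} {ι : Type*} (S : Finset ι) {β : ι → Fin n → ℕ} {c : ι → ℝ}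
    {P : ι → (Fin n → ℝ) → ℝ} (h : ∀ i ∈ S, HasLeadingTerm (β i) (c i) (P i)) :
    HasLeadingTerm (∑ i ∈ S, β i) (∏ i ∈ S, c i) (fun x => ∏ i ∈ S, P i x) := by
  classical
  induction S using Finset.induction_on with
  | empty => simpa using one
  | insert i S hi ih =>
    simp only [Finset.sum_insert hi, Finset.prod_insert hi]
    exact (h i (Finset.mem_insert_self _ _)).mul
      (ih fun k hk => h k (Finset.mem_insert_of_mem hk))

lemma monomial {n : ℕ} (β : Fin n → ℕ) : HasLeadingTerm β 1 (fun x => ∏ i, x i ^ β i) := by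
  induction n with
  | zero => intro x; simp
  | succ n ih =>
    refine ⟨by fun_prop, _, ih _, fun y => ?_⟩
    refine ⟨Polynomial.C (∏ i, y i ^ Fin.tail β i) * Polynomial.X ^ β 0,
      Polynomial.natDegree_C_mul_X_pow_le _ _, ?_, fun t => ?_⟩
    · rw [Polynomial.coeff_C_mul_X_pow, if_pos rfl]
    · rw [Polynomial.eval_mul, Polynomial.eval_C, Polynomial.eval_pow, Polynomial.eval_X]
      simp [Fin.prod_univ_succ, Fin.tail, mul_comm]

/-- Coefficient 0 is allowed for a leading term, so dictionary-smaller monomials can be added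
without changing the leading coefficient. -/
lemma monomial_of_lt {n : ℕ} {α β : Fin n → ℕ} (h : toLex α < toLex β) :
    HasLeadingTerm β 0 (fun x => ∏ i, x i ^ α i) := by
  induction n with
  | zero => obtain ⟨i, -⟩ := h; exact i.elim0
  | succ n ih =>
    obtain ⟨i, hi, hlt⟩ := h
    have key : ∃ Q, HasLeadingTerm (Fin.tail β) 0 Q ∧ ∀ y,
        (Polynomial.C (∏ i, y i ^ Fin.tail α i) * Polynomial.X ^ α 0).coeff (β 0) = Q y ∧
        α 0 ≤ β 0 := by
      refine Fin.cases (fun hi hlt => ?_) (fun j hi hlt => ?_) i hi hlt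
      · refine ⟨_, zero _, fun y => ⟨?_, hlt.le⟩⟩
        rw [Polynomial.coeff_C_mul_X_pow, if_neg (ne_of_gt (show α 0 < β 0 from hlt))]
      · have h0 : α 0 = β 0 := hi 0 (Fin.succ_pos j)
        refine ⟨_, ih (α := Fin.tail α) ⟨j, fun k hk => hi k.succ (Fin.succ_lt_succ_iff.2 hk), hlt⟩,
          fun y => ⟨?_, h0.le⟩⟩
        rw [Polynomial.coeff_C_mul_X_pow, if_pos h0.symm]
    obtain ⟨Q, hQ, hy⟩ := key
    refine ⟨by fun_prop, Q, hQ, fun y => ⟨_, ?_, (hy y).1, fun t => ?_⟩⟩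
    · exact (Polynomial.natDegree_C_mul_X_pow_le _ _).trans (hy y).2
    · rw [Polynomial.eval_mul, Polynomial.eval_C, Polynomial.eval_pow, Polynomial.eval_X]
      simp [Fin.prod_univ_succ, Fin.tail, mul_comm]

end HasLeadingTerm

/-! ### Comparison of polynomials with their leading terms -/

/-- Let Z contain the real parts of all complex roots, and z be its point nearest to t. Every root w
satisfies |t - w| ≥ |t - Re w| ≥ |t - z|, so each linear factor is at least |t - z|. One z serves
all the polynomials simultaneously. -/
lemma exists_finset_abs_coeff_mul_le {ι : Type*} [Fintype ι] (p : ι → Polynomial ℝ) (D : ι → ℕ)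
    (hp : ∀ m, (p m).natDegree ≤ D m) :
    ∃ Z : Finset ℝ, Z.card ≤ 1 + ∑ m, D m ∧
      ∀ t : ℝ, ∃ z ∈ Z, ∀ m, |(p m).coeff (D m)| * |t - z| ^ D m ≤ |(p m).eval t| := by
  classical
  let q : ι → Polynomial ℂ := fun m => (p m).map (algebraMap ℝ ℂ)
  -- The extra point 0 keeps the set nonempty when no polynomial has a root.
  refine ⟨{0} ∪ Finset.univ.biUnion fun m => (q m).roots.toFinset.image Complex.re, ?_, ?_⟩
  · refine (Finset.card_union_le _ _).trans (add_le_add (by simp) ?_)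
    refine Finset.card_biUnion_le.trans (Finset.sum_le_sum fun m _ => ?_)
    refine Finset.card_image_le.trans ((Multiset.toFinset_card_le _).trans ?_)
    exact (Polynomial.card_roots' _).trans ((Polynomial.natDegree_map_le).trans (hp m))
  · intro t
    obtain ⟨z, hz, hmin⟩ := Finset.exists_min_image
      ({0} ∪ Finset.univ.biUnion fun m => (q m).roots.toFinset.image Complex.re)
      (fun z => |t - z|) ⟨0, by simp⟩
    refine ⟨z, hz, fun m => ?_⟩
    rcases eq_or_ne ((p m).coeff (D m)) 0 with h0 | h0
    · simp [h0]
    have hdeg : (p m).natDegree = D m := le_antisymm (hp m) (Polynomial.le_natDegree_of_ne_zero h0)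
    have hs : (q m).Splits := IsAlgClosed.splits _
    have hcard : Multiset.card (q m).roots = D m := by
      rw [← hdeg, ← Polynomial.natDegree_map (algebraMap ℝ ℂ)]
      exact hs.natDegree_eq_card_roots.symm
    have hlead : (q m).leadingCoeff = ((p m).coeff (D m) : ℂ) := by
      rw [Polynomial.leadingCoeff_map, Polynomial.leadingCoeff, hdeg]; rfl
    have hev : |(p m).eval t| = ‖(q m).eval (t : ℂ)‖ := by
      have : (q m).eval (t : ℂ) = (((p m).eval t : ℝ) : ℂ) := by
        exact (Polynomial.eval_map_algebraMap (p m) (t : ℂ)).trans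
          (Polynomial.aeval_algebraMap_apply_eq_algebraMap_eval t (p m))
      rw [this, Complex.norm_real, Real.norm_eq_abs]
    rw [hev, hs.eval_eq_prod_roots, norm_mul, hlead, Complex.norm_real, Real.norm_eq_abs]
    refine mul_le_mul_of_nonneg_left ?_ (abs_nonneg _)
    have hle : ∀ w ∈ (q m).roots, |t - z| ≤ ‖(t : ℂ) - w‖ := by
      intro w hw
      have h1 := hmin w.re (Finset.mem_union_right _ (Finset.mem_biUnion.2
        ⟨m, Finset.mem_univ _, Finset.mem_image_of_mem _ (Multiset.mem_toFinset.2 hw)⟩))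
      refine h1.trans ?_
      simpa using Complex.abs_re_le_norm ((t : ℂ) - w)
    rw [← hcard]
    clear hcard
    generalize (q m).roots = R at hle
    induction R using Multiset.induction_on with
    | empty => simp
    | cons w R ih =>
      simp only [Multiset.card_cons, pow_succ', Multiset.map_cons, Multiset.prod_cons, norm_mul]
      exact mul_le_mul (hle w (Multiset.mem_cons_self _ _))
        (ih fun v hv => hle v (Multiset.mem_cons_of_mem hv)) (by positivity) (norm_nonneg _)

lemma lintegral_insertNth {n : ℕ} {X : Type*} [MeasureSpace X]
    [SigmaFinite (volume : Measure X)] (i : Fin (n + 1)) {f : (Fin (n + 1) → X) → ℝ≥0∞}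
    (hf : Measurable f) :
    ∫⁻ x, f x = ∫⁻ t : X, ∫⁻ y : Fin n → X, f (Fin.insertNth i t y) := by
  rw [← (volume_preserving_piFinSuccAbove (fun _ => X) i).symm.lintegral_comp_emb
    (MeasurableEquiv.measurableEmbedding _) f]
  exact lintegral_prod _ (hf.comp (MeasurableEquiv.measurable _)).aemeasurable

lemma measurable_insertNth {n : ℕ} {X : Type*} [MeasurableSpace X] (i : Fin (n + 1)) :
    Measurable fun z : X × (Fin n → X) => (Fin.insertNth i z.1 z.2 : Fin (n + 1) → X) :=
  (MeasurableEquiv.piFinSuccAbove (fun _ => X) i).symm.measurable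

lemma lintegral_abs_eq_two_mul_lintegral_exp (h : ℝ → ℝ≥0∞) :
    ∫⁻ t : ℝ, h |t| = 2 * ∫⁻ u : ℝ, h (Real.exp u) * ENNReal.ofReal (Real.exp u) := by
  have h1 : ∫⁻ t in Set.Ioi (0 : ℝ), h t =
      ∫⁻ u : ℝ, h (Real.exp u) * ENNReal.ofReal (Real.exp u) := by
    have := lintegral_image_eq_lintegral_abs_deriv_mul (s := Set.univ) (f := Real.exp)
      (f' := Real.exp) MeasurableSet.univ (fun x _ => (Real.hasDerivAt_exp x).hasDerivWithinAt)
      Real.exp_injective.injOn h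
    rw [Set.image_univ, Real.range_exp] at this
    rw [this, Measure.restrict_univ]
    refine lintegral_congr fun u => ?_
    rw [abs_of_pos (Real.exp_pos u), mul_comm]
  have h2 : ∫⁻ t in Set.Ioi (0 : ℝ), h |t| = ∫⁻ t in Set.Ioi (0 : ℝ), h t :=
    setLIntegral_congr_fun measurableSet_Ioi fun t ht => by
      rw [abs_of_pos (Set.mem_Ioi.1 ht)]
  have h3 : ∫⁻ t in Set.Iic (0 : ℝ), h |t| = ∫⁻ t in Set.Ioi (0 : ℝ), h |t| := by
    have e : MeasurePreserving (Neg.neg : ℝ → ℝ) volume volume := Measure.measurePreserving_neg _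
    have := e.setLIntegral_comp_preimage_emb (MeasurableEquiv.neg ℝ).measurableEmbedding
      (fun t => h |t|) (Set.Iio 0)
    rw [setLIntegral_congr (Iio_ae_eq_Iic (a := (0 : ℝ)))] at this
    rw [← this]
    simp
  rw [← lintegral_add_compl _ measurableSet_Ioi (A := Set.Ioi (0 : ℝ)), Set.compl_Ioi, h3, h2, h1,
    two_mul]

/-- The integral of a decreasing function of the absolute values of several polynomials is bounded
by that of the same function of their leading terms. -/
lemma lintegral_comp_abs_eval_le {ι : Type*} [Fintype ι] (p : ι → Polynomial ℝ) (D : ι → ℕ)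
    (hp : ∀ m, (p m).natDegree ≤ D m) (G : (ι → ℝ) → ℝ≥0∞) (hG : Measurable G)
    (hanti : ∀ y z : ι → ℝ, 0 ≤ y → y ≤ z → G z ≤ G y) :
    ∫⁻ t : ℝ, G (fun m => |(p m).eval t|) ≤ ((2 * (1 + ∑ m, D m) : ℕ) : ℝ≥0∞) *
      ∫⁻ u : ℝ, G (fun m => |(p m).coeff (D m)| * Real.exp u ^ D m) *
        ENNReal.ofReal (Real.exp u) := by
  obtain ⟨Z, hZ, hz⟩ := exists_finset_abs_coeff_mul_le p D hp
  set H : ℝ → ℝ≥0∞ := fun t => G (fun m => |(p m).coeff (D m)| * t ^ D m) with hH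
  have hHm : Measurable H := hG.comp (by fun_prop)
  calc ∫⁻ t : ℝ, G (fun m => |(p m).eval t|) ≤ ∫⁻ t : ℝ, ∑ z ∈ Z, H |t - z| := by
        refine lintegral_mono fun t => ?_
        obtain ⟨z, hzZ, hle⟩ := hz t
        refine (hanti _ _ (fun m => by positivity) hle).trans ?_
        exact Finset.single_le_sum (f := fun z => H |t - z|) (fun _ _ => zero_le) hzZ
    _ = ∑ z ∈ Z, ∫⁻ t : ℝ, H |t| := by
        rw [lintegral_finsetSum (f := fun z t => H |t - z|) _ fun z _ => hHm.comp (by fun_prop)]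
        exact Finset.sum_congr rfl fun z _ => lintegral_sub_right_eq_self (fun t => H |t|) z
    _ = (Z.card : ℝ≥0∞) * ∫⁻ t : ℝ, H |t| := by rw [Finset.sum_const, nsmul_eq_mul]
    _ ≤ ((1 + ∑ m, D m : ℕ) : ℝ≥0∞) * ∫⁻ t : ℝ, H |t| := by gcongr
    _ = _ := by
        rw [lintegral_abs_eq_two_mul_lintegral_exp, ← mul_assoc]
        congr 1
        push_cast; ring

/-- Fubini and induction on n: the one-variable bound treats the first coordinate, and the leading
coefficients `Q` are handled by the induction hypothesis, since rescaling the arguments of `G` by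
positive factors keeps it decreasing. -/
theorem lintegral_comp_abs_le {n : ℕ} {ι : Type*} [Fintype ι] (β : ι → Fin n → ℕ)
    (P : ι → (Fin n → ℝ) → ℝ) (hP : ∀ m, HasLeadingTerm (β m) 1 (P m))
    (G : (ι → ℝ) → ℝ≥0∞) (hG : Measurable G)
    (hanti : ∀ y z : ι → ℝ, 0 ≤ y → y ≤ z → G z ≤ G y) :
    ∫⁻ x, G (fun m => |P m x|) ≤ ((∏ i, 2 * (1 + ∑ m, β m i) : ℕ) : ℝ≥0∞) *
      ∫⁻ u : Fin n → ℝ, G (fun m => Real.exp (∑ i, β m i * u i)) *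
        ENNReal.ofReal (Real.exp (∑ i, u i)) := by
  induction n generalizing G with
  | zero =>
    have h : ∀ m x, P m x = 1 := hP
    simp [h]
  | succ n ih =>
    choose hPm Q hQ hp using hP
    have hQm : ∀ m, Measurable (Q m) := fun m => (hQ m).measurable
    have hGs : ∀ t : ℝ, Measurable fun y : ι → ℝ => G (fun m => y m * Real.exp t ^ β m 0) :=
      fun t => hG.comp (by fun_prop)
    have hant : ∀ t : ℝ, ∀ y z : ι → ℝ, 0 ≤ y → y ≤ z →
        G (fun m => z m * Real.exp t ^ β m 0) ≤ G (fun m => y m * Real.exp t ^ β m 0) := by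
      intro t y z hy hyz
      refine hanti _ _ (fun m => mul_nonneg (hy m) (by positivity)) fun m => ?_
      exact mul_le_mul_of_nonneg_right (hyz m) (by positivity)
    have hmeasP : Measurable fun x => G (fun m => |P m x|) := by fun_prop
    calc ∫⁻ x, G (fun m => |P m x|)
        = ∫⁻ y : Fin n → ℝ, ∫⁻ t : ℝ, G (fun m => |P m (Fin.insertNth 0 t y)|) := by
          rw [lintegral_insertNth 0 hmeasP, lintegral_lintegral_swap]
          exact (hmeasP.comp (measurable_insertNth 0)).aemeasurable
      _ ≤ ∫⁻ y : Fin n → ℝ, ((2 * (1 + ∑ m, β m 0) : ℕ) : ℝ≥0∞) *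
            ∫⁻ t : ℝ, G (fun m => |Q m y| * Real.exp t ^ β m 0) * ENNReal.ofReal (Real.exp t) := by
          refine lintegral_mono fun y => ?_
          choose p h1 h2 h3 using fun m => hp m y
          have := lintegral_comp_abs_eval_le p (fun m => β m 0) h1 G hG hanti
          simpa only [Fin.insertNth_zero', h3, h2] using this
      _ = ((2 * (1 + ∑ m, β m 0) : ℕ) : ℝ≥0∞) * ∫⁻ t : ℝ, ∫⁻ y : Fin n → ℝ,
            G (fun m => |Q m y| * Real.exp t ^ β m 0) * ENNReal.ofReal (Real.exp t) := by
          have hm : Measurable fun z : (Fin n → ℝ) × ℝ =>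
            G (fun m => |Q m z.1| * Real.exp z.2 ^ β m 0) * ENNReal.ofReal (Real.exp z.2) := by
            refine (hG.comp (measurable_pi_lambda _ fun m => ?_)).mul (by fun_prop)
            exact (((hQm m).comp measurable_fst).abs).mul (by fun_prop)
          rw [lintegral_const_mul _ hm.lintegral_prod_right', lintegral_lintegral_swap]
          exact hm.aemeasurable
      _ ≤ ((2 * (1 + ∑ m, β m 0) : ℕ) : ℝ≥0∞) * ∫⁻ t : ℝ,
            ((∏ i : Fin n, 2 * (1 + ∑ m, β m i.succ) : ℕ) : ℝ≥0∞) * (∫⁻ u : Fin n → ℝ,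
              G (fun m => Real.exp (∑ i, β m i.succ * u i) * Real.exp t ^ β m 0) *
                ENNReal.ofReal (Real.exp (∑ i, u i))) * ENNReal.ofReal (Real.exp t) := by
          gcongr with t
          rw [lintegral_mul_const' _ _ ENNReal.ofReal_ne_top]
          gcongr
          exact ih _ _ hQ _ (hGs t) (hant t)
      _ = ((∏ i, 2 * (1 + ∑ m, β m i) : ℕ) : ℝ≥0∞) * ∫⁻ t : ℝ, ∫⁻ u : Fin n → ℝ,
              G (fun m => Real.exp (∑ i, β m i.succ * u i) * Real.exp t ^ β m 0) *
                ENNReal.ofReal (Real.exp (∑ i, u i)) * ENNReal.ofReal (Real.exp t) := by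
          rw [Fin.prod_univ_succ, Nat.cast_mul _ (∏ i : Fin n, _), mul_assoc]
          congr 1
          rw [← lintegral_const_mul' _ _ (ENNReal.natCast_ne_top _)]
          refine lintegral_congr fun t => ?_
          rw [lintegral_mul_const' _ _ ENNReal.ofReal_ne_top, mul_assoc]
      _ = _ := by
          congr 1
          rw [lintegral_insertNth 0 (by fun_prop)]
          refine lintegral_congr fun t => lintegral_congr fun u => ?_
          rw [mul_assoc, ← ENNReal.ofReal_mul (Real.exp_pos _).le, ← Real.exp_add]
          simp only [Fin.insertNth_zero', Fin.sum_univ_succ, Fin.cons_zero, Fin.cons_succ,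
            ← Real.exp_nat_mul, ← Real.exp_add]
          simp only [add_comm]

/-! ### The monomial integral, uniformly in the weights -/

lemma integrable_exp_neg_mul_abs {δ : ℝ} (hδ : 0 < δ) :
    Integrable fun t : ℝ => Real.exp (-(δ * |t|)) := by
  rw [← integrableOn_univ, ← Set.Iic_union_Ioi (a := (0 : ℝ))]
  refine IntegrableOn.union ?_ ?_
  · refine (integrableOn_exp_mul_Iic hδ 0).congr_fun (fun t ht => ?_) measurableSet_Iic
    simp [abs_of_nonpos (Set.mem_Iic.1 ht)]
  · refine (integrableOn_exp_mul_Ioi (neg_neg_of_pos hδ) 0).congr_fun (fun t ht => ?_)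
      measurableSet_Ioi
    simp [abs_of_pos (Set.mem_Ioi.1 ht)]

/-- An invertible linear change of variables decouples the integral, and translation invariance
makes the bound independent of `c`. -/
lemma exists_lintegral_exp_neg_le {n : ℕ} {δ : ℝ} (hδ : 0 < δ) (v : Fin n → Fin n → ℝ)
    (hv : LinearIndependent ℝ v) :
    ∃ C : ℝ≥0∞, C ≠ ∞ ∧ ∀ c : Fin n → ℝ,
      ∫⁻ u : Fin n → ℝ, ENNReal.ofReal (Real.exp (-(δ * ∑ j, |∑ i, v j i * u i - c j|))) ≤ C := by
  set L : (Fin n → ℝ) →ₗ[ℝ] (Fin n → ℝ) := (Matrix.of v).mulVecLin with hL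
  have hdet : LinearMap.det L ≠ 0 := by
    have h : IsUnit (Matrix.of v) := Matrix.linearIndependent_rows_iff_isUnit.1 hv
    rw [hL, ← Matrix.toLin'_apply', LinearMap.det_toLin']
    exact ((Matrix.isUnit_iff_isUnit_det _).1 h).ne_zero
  set E : (Fin n → ℝ) → ℝ≥0∞ := fun y => ENNReal.ofReal (Real.exp (-(δ * ∑ j, |y j|))) with hE
  have hEm : Measurable E := by fun_prop
  have hfin : ∫⁻ y, E y ≠ ∞ := by
    have h := Integrable.fintype_prod (f := fun (_ : Fin n) (t : ℝ) => Real.exp (-(δ * |t|)))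
      (μ := fun _ => volume) fun _ => integrable_exp_neg_mul_abs hδ
    have h2 := h.lintegral_lt_top.ne
    convert! h2 using 3 with y
    rw [← Real.exp_sum, Finset.sum_neg_distrib, ← Finset.mul_sum]
  refine ⟨ENNReal.ofReal |(LinearMap.det L)⁻¹| * ∫⁻ y, E y,
    ENNReal.mul_ne_top ENNReal.ofReal_ne_top hfin, fun c => ?_⟩
  calc ∫⁻ u : Fin n → ℝ, ENNReal.ofReal (Real.exp (-(δ * ∑ j, |∑ i, v j i * u i - c j|)))
      = ∫⁻ u : Fin n → ℝ, E (L u - c) := rfl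
    _ = ∫⁻ y, E (y - c) ∂(Measure.map L volume) :=
        (lintegral_map (hEm.comp (measurable_id.sub_const c))
          L.continuous_of_finiteDimensional.measurable).symm
    _ = ENNReal.ofReal |(LinearMap.det L)⁻¹| * ∫⁻ y, E y := by
        rw [Real.map_linearMap_volume_pi_eq_smul_volume_pi hdet, lintegral_smul_measure,
          lintegral_sub_right_eq_self E c, smul_eq_mul]
    _ ≤ _ := le_rfl

lemma exists_injective_linearIndependent {n : ℕ} {ι : Type*} (w : ι → Fin n → ℝ)
    (hw : Submodule.span ℝ (Set.range w) = ⊤) :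
    ∃ e : Fin n → ι, Function.Injective e ∧ LinearIndependent ℝ fun j => w (e j) := by
  obtain ⟨κ, a, ha, hsp, hli⟩ := exists_linearIndependent' ℝ w
  let B := Module.Basis.mk hli (by rw [hsp, hw])
  let B' := B.reindex (B.indexEquiv (Pi.basisFun ℝ (Fin n)))
  have hB' : ∀ j, B' j = w (a ((B.indexEquiv (Pi.basisFun ℝ (Fin n))).symm j)) := by
    intro j; simp [B', B]
  refine ⟨fun j => a ((B.indexEquiv (Pi.basisFun ℝ (Fin n))).symm j),
    ha.comp (Equiv.injective _), ?_⟩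
  have := B'.linearIndependent
  rwa [funext hB'] at this

/-- Let l_m be the exponents and M the logarithm of their exponential sum, so M ≥ l_m. By scaling
and ∏ b = 1 the integrand is exp(-(1/s) ∑ (M - l_m)). This sum of nonnegative terms controls every
difference l_m - l_{m₀}; as β_{m₀} = 0, n of these are linearly independent linear forms in u up to
constants, which gives exponential decay. -/
theorem exists_lintegral_sum_exp_rpow_le {n : ℕ} (hn : 0 < n) {ι : Type*} [Fintype ι]
    (β : ι → Fin n → ℕ) {s : ℕ} (hs : 0 < s) (hsum : ∀ i, ∑ m, β m i = s)
    (hspan : Submodule.span ℝ (Set.range fun m (i : Fin n) => (β m i : ℝ)) = ⊤)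
    {m₀ : ι} (h₀ : β m₀ = 0) :
    ∃ C : ℝ≥0∞, C ≠ ∞ ∧ ∀ b : ι → ℝ, (∀ m, 0 < b m) → ∏ m, b m = 1 →
      ∫⁻ u : Fin n → ℝ,
        ENNReal.ofReal (∑ m, Real.exp (∑ i, β m i * u i) / b m) ^ (-(Fintype.card ι / s : ℝ)) *
          ENNReal.ofReal (Real.exp (∑ i, u i)) ≤ C := by
  classical
  obtain ⟨e, he, hli⟩ := exists_injective_linearIndependent _ hspan
  have hs' : (0 : ℝ) < s := by exact_mod_cast hs
  have hn' : (0 : ℝ) < n := by exact_mod_cast hn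
  have hδ : (0 : ℝ) < 1 / (s * n) := by positivity
  obtain ⟨C, hC, hle⟩ := exists_lintegral_exp_neg_le hδ _ hli
  refine ⟨C, hC, fun b hb hb1 => ?_⟩
  refine le_trans (lintegral_mono fun u => ?_)
    (hle fun j => Real.log (b (e j)) - Real.log (b m₀))
  set l : ι → ℝ := fun m => ∑ i, (β m i : ℝ) * u i - Real.log (b m) with hl
  have hexp : ∀ m, Real.exp (∑ i, β m i * u i) / b m = Real.exp (l m) := fun m => by
    rw [hl]; simp only [Real.exp_sub, Real.exp_log (hb m)]
  simp only [hexp]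
  have hpos : 0 < ∑ m, Real.exp (l m) :=
    Finset.sum_pos (fun m _ => Real.exp_pos _) ⟨m₀, Finset.mem_univ _⟩
  set M := Real.log (∑ m, Real.exp (l m)) with hM
  have hlM : ∀ m, l m ≤ M := fun m => by
    rw [hM, Real.le_log_iff_exp_le hpos]
    exact Finset.single_le_sum (f := fun m => Real.exp (l m)) (fun _ _ => (Real.exp_pos _).le)
      (Finset.mem_univ m)
  have hlsum : ∑ m, l m = s * ∑ i, u i := by
    have hlog : ∑ m, Real.log (b m) = 0 := by
      rw [← Real.log_prod fun m _ => (hb m).ne', hb1, Real.log_one]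
    rw [hl, Finset.sum_sub_distrib, hlog, sub_zero, Finset.sum_comm, Finset.mul_sum]
    refine Finset.sum_congr rfl fun i _ => ?_
    rw [← Finset.sum_mul, ← hsum i]; push_cast; rfl
  rw [ENNReal.ofReal_rpow_of_pos hpos, ← ENNReal.ofReal_mul (by positivity),
    Real.rpow_def_of_pos hpos, ← hM, ← Real.exp_add]
  refine ENNReal.ofReal_le_ofReal (Real.exp_le_exp.2 ?_)
  -- The zero vector cannot belong to a linearly independent family.
  have hm₀ : m₀ ∉ Finset.univ.image e := by
    intro h
    obtain ⟨j, -, hj⟩ := Finset.mem_image.1 h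
    refine hli.ne_zero j ?_
    simp only [hj, h₀]
    ext i; simp
  have hl0 : l m₀ = -Real.log (b m₀) := by simp [hl, h₀]
  have h1 : (M - l m₀) + ∑ j, (M - l (e j)) ≤ ∑ m, (M - l m) := by
    have := Finset.sum_le_sum_of_subset_of_nonneg (Finset.subset_univ
      (insert m₀ (Finset.univ.image e))) (f := fun m => M - l m)
      (fun m _ _ => sub_nonneg.2 (hlM m))
    rwa [Finset.sum_insert hm₀, Finset.sum_image he.injOn] at this
  have h2 : ∑ j, |∑ i, (β (e j) i : ℝ) * u i - (Real.log (b (e j)) - Real.log (b m₀))| ≤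
      ∑ j, (M - l (e j)) + n * (M - l m₀) := by
    calc _ ≤ ∑ j : Fin n, ((M - l (e j)) + (M - l m₀)) := by
          refine Finset.sum_le_sum fun j _ => ?_
          have e1 : ∑ i, (β (e j) i : ℝ) * u i - (Real.log (b (e j)) - Real.log (b m₀)) =
              l (e j) - l m₀ := by rw [hl0]; simp only [hl]; ring
          rw [e1, abs_le]
          constructor <;> linarith [hlM (e j), hlM m₀]
      _ = _ := by rw [Finset.sum_add_distrib]; simp [mul_sub]
  have h3 : ∑ m, (M - l m) = Fintype.card ι * M - s * ∑ i, u i := by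
    rw [Finset.sum_sub_distrib, hlsum]; simp
  have hn1 : (1 : ℝ) ≤ n := by exact_mod_cast hn
  have h4 : ∑ j, (M - l (e j)) ≤ n * ∑ j, (M - l (e j)) :=
    le_mul_of_one_le_left (Finset.sum_nonneg fun j _ => sub_nonneg.2 (hlM _)) hn1
  have h5 : ∑ j, |∑ i, (β (e j) i : ℝ) * u i - (Real.log (b (e j)) - Real.log (b m₀))| ≤
      n * (Fintype.card ι * M - s * ∑ i, u i) := by
    rw [← h3]
    refine h2.trans ?_
    have := mul_le_mul_of_nonneg_left h1 hn'.le
    linarith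
  calc M * -(Fintype.card ι / s : ℝ) + ∑ i, u i
      = -(1 / (s * n) * (n * (Fintype.card ι * M - s * ∑ i, u i))) := by field_simp; ring
    _ ≤ _ := neg_le_neg (mul_le_mul_of_nonneg_left h5 hδ.le)

/-! ### Reverse Hölder inequality -/

/-- A reverse Hölder inequality against polynomials with prescribed leading terms. -/
theorem exists_lintegral_rpow_le {n : ℕ} (hn : 0 < n) {ι : Type*} [Fintype ι]
    (β : ι → Fin n → ℕ) {s : ℕ} (hs : 0 < s) (hsum : ∀ i, ∑ m, β m i = s)
    (hspan : Submodule.span ℝ (Set.range fun m (i : Fin n) => (β m i : ℝ)) = ⊤)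
    {m₀ : ι} (h₀ : β m₀ = 0) {p : ℝ} (hp : p = Fintype.card ι / (Fintype.card ι + s)) :
    ∃ C : ℝ≥0∞, C ≠ ∞ ∧ ∀ b : ι → ℝ, (∀ m, 0 < b m) → ∏ m, b m = 1 →
      ∀ P : ι → (Fin n → ℝ) → ℝ, (∀ m, HasLeadingTerm (β m) 1 (P m)) →
      ∀ g : (Fin n → ℝ) → ℝ≥0∞, Measurable g →
        (∫⁻ x, g x ^ p) ^ (1 / p) ≤
          C * ∑ m, ENNReal.ofReal (b m)⁻¹ * ∫⁻ x, ENNReal.ofReal |P m x| * g x := by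
  obtain ⟨C, hC, hle⟩ := exists_lintegral_sum_exp_rpow_le hn β hs hsum hspan h₀
  have hs' : (0 : ℝ) < s := by exact_mod_cast hs
  have hN : (0 : ℝ) < Fintype.card ι := by
    have : 0 < Fintype.card ι := Fintype.card_pos_iff.2 ⟨m₀⟩
    exact_mod_cast this
  have hp0 : 0 < p := by rw [hp]; positivity
  have hp1 : 0 < 1 - p := by rw [hp]; field_simp; linarith
  set r : ℝ := Fintype.card ι / s with hr
  have hr0 : 0 < r := by positivity
  -- This identity fixes r = N/s: the power of w produced by Hölder then cancels w^p.
  have hrp : -r * (1 - p) = -p := by rw [hr, hp]; field_simp; ring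
  set K : ℝ≥0∞ := ((∏ i, 2 * (1 + ∑ m, β m i) : ℕ) : ℝ≥0∞) * C with hK
  have hKt : K ≠ ∞ := ENNReal.mul_ne_top (ENNReal.natCast_ne_top _) hC
  refine ⟨(K ^ (1 - p)) ^ (1 / p), ?_, fun b hb hb1 P hP g hg => ?_⟩
  · exact ENNReal.rpow_ne_top_of_nonneg (by positivity)
      (ENNReal.rpow_ne_top_of_nonneg hp1.le hKt)
  have hPm : ∀ m, Measurable (P m) := fun m => (hP m).measurable
  set w : (Fin n → ℝ) → ℝ≥0∞ := fun x => ENNReal.ofReal (∑ m, |P m x| / b m) with hw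
  have hwm : Measurable w := by fun_prop
  have hwK : ∫⁻ x, w x ^ (-r) ≤ K := by
    refine (lintegral_comp_abs_le β P hP
      (fun y => ENNReal.ofReal (∑ m, y m / b m) ^ (-r)) (by fun_prop) ?_).trans ?_
    · intro y z hy hyz
      rw [ENNReal.rpow_neg, ENNReal.rpow_neg, ENNReal.inv_le_inv]
      refine ENNReal.rpow_le_rpow (ENNReal.ofReal_le_ofReal ?_) hr0.le
      exact Finset.sum_le_sum fun m _ => div_le_div_of_nonneg_right (hyz m) (hb m).le
    · exact mul_le_mul_right (hle b hb hb1) _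
  -- A negative power of w is integrable, so w vanishes only on a null set.
  have hw0 : ∀ᵐ x, w x ≠ 0 := by
    filter_upwards [ae_lt_top (by fun_prop) (ne_top_of_le_ne_top hKt hwK)] with x hx h
    rw [h, ENNReal.zero_rpow_of_neg (by linarith)] at hx
    exact lt_irrefl _ hx
  have hholder : ∫⁻ x, g x ^ p ≤ (∫⁻ x, w x * g x) ^ p * K ^ (1 - p) := by
    calc ∫⁻ x, g x ^ p = ∫⁻ x, (w x * g x) ^ p * (w x ^ (-r)) ^ (1 - p) := by
          refine lintegral_congr_ae ?_
          filter_upwards [hw0] with x hx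
          rw [← ENNReal.rpow_mul, hrp, ENNReal.mul_rpow_of_nonneg _ _ hp0.le, mul_comm, ← mul_assoc,
            ← ENNReal.rpow_add _ _ hx ENNReal.ofReal_ne_top, neg_add_cancel, ENNReal.rpow_zero,
            one_mul]
      _ ≤ (∫⁻ x, w x * g x) ^ p * (∫⁻ x, w x ^ (-r)) ^ (1 - p) :=
          ENNReal.lintegral_mul_norm_pow_le (by fun_prop) (by fun_prop) hp0.le hp1.le (by ring)
      _ ≤ _ := by gcongr
  have hsumw : ∫⁻ x, w x * g x =
      ∑ m, ENNReal.ofReal (b m)⁻¹ * ∫⁻ x, ENNReal.ofReal |P m x| * g x := by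
    have : ∀ x, w x * g x =
        ∑ m, ENNReal.ofReal (b m)⁻¹ * (ENNReal.ofReal |P m x| * g x) := by
      intro x
      rw [hw]
      simp only
      rw [ENNReal.ofReal_sum_of_nonneg fun m _ => div_nonneg (abs_nonneg _) (hb m).le,
        Finset.sum_mul]
      refine Finset.sum_congr rfl fun m _ => ?_
      rw [← mul_assoc, ← ENNReal.ofReal_mul (inv_pos.2 (hb m)).le, div_eq_inv_mul]
    simp only [this]
    rw [lintegral_finsetSum _ fun m _ => by fun_prop]
    exact Finset.sum_congr rfl fun m _ => lintegral_const_mul _ (by fun_prop)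
  calc (∫⁻ x, g x ^ p) ^ (1 / p)
      ≤ ((∫⁻ x, w x * g x) ^ p * K ^ (1 - p)) ^ (1 / p) := by gcongr
    _ = _ := by
        rw [ENNReal.mul_rpow_of_nonneg _ _ (by positivity), ← ENNReal.rpow_mul,
          mul_one_div_cancel hp0.ne', ENNReal.rpow_one, hsumw, mul_comm]

/-! ### Assignment duality and weighted bounds -/

/-- Approximate duality for the assignment problem. -/
lemma exists_assignment_dual {ι : Type*} [Fintype ι] (G : ι → ι → ℝ) :
    ∃ (a u : ι → ℝ) (σ : Equiv.Perm ι), (∀ j m, G j m ≤ a j + u m) ∧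
      ∀ j, a j + u (σ j) - 1 ≤ G j (σ j) := by
  classical
  let feas : Set ((ι → ℝ) × (ι → ℝ)) := {z | ∀ j m, G j m ≤ z.1 j + z.2 m}
  let φ : (ι → ℝ) × (ι → ℝ) → ℝ := fun z => ∑ j, z.1 j + ∑ j, z.2 j
  have hne : (φ '' feas).Nonempty := by
    refine ⟨_, (fun j => ∑ m, |G j m|, 0), fun j m => ?_, rfl⟩
    simpa using (le_abs_self _).trans (Finset.single_le_sum (f := fun m => |G j m|)
      (fun _ _ => abs_nonneg _) (Finset.mem_univ m))
  have hbdd : BddBelow (φ '' feas) := by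
    refine ⟨∑ j, G j j, ?_⟩
    rintro _ ⟨z, hz, rfl⟩
    simp only [φ, ← Finset.sum_add_distrib]
    exact Finset.sum_le_sum fun j _ => hz j j
  obtain ⟨_, ⟨z, hz, rfl⟩, hlt⟩ := exists_lt_of_csInf_lt hne (lt_add_one (sInf (φ '' feas)))
  -- The pairs tight up to 1, for a dual point within 1 of the optimum. A matching among them is the
  -- required σ, and Hall's theorem supplies it.
  let t : ι → Finset ι := fun j => Finset.univ.filter fun m => z.1 j + z.2 m - 1 ≤ G j m
  have hall : ∀ S : Finset ι, S.card ≤ (S.biUnion t).card := by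
    intro S
    by_contra! hcard
    -- If Hall's condition fails on S, lowering a by 1 on S and raising u by 1 on its neighbours
    -- stays feasible and lowers the objective by at least 1, below the infimum.
    let z' : (ι → ℝ) × (ι → ℝ) :=
      (fun j => z.1 j - if j ∈ S then 1 else 0, fun m => z.2 m + if m ∈ S.biUnion t then 1 else 0)
    have hz' : z' ∈ feas := by
      intro j m
      have h := hz j m
      by_cases hj : j ∈ S
      · by_cases hm : m ∈ S.biUnion t
        · simp only [z', hj, hm, if_true]; linarith
        · have hjm : m ∉ t j := fun h' => hm (Finset.mem_biUnion.2 ⟨j, hj, h'⟩)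
          have hjm' : G j m < z.1 j + z.2 m - 1 := by
            simpa [t, lt_sub_iff_add_lt] using hjm
          simp only [z', hj, hm, if_true, if_false]; linarith
      · have : (0 : ℝ) ≤ if m ∈ S.biUnion t then 1 else 0 := by split_ifs <;> norm_num
        simp only [z', hj, if_false]; linarith
    have hφ : φ z' = φ z - S.card + (S.biUnion t).card := by
      simp only [φ, z', Finset.sum_sub_distrib, Finset.sum_add_distrib, Finset.sum_ite_mem,
        Finset.univ_inter, Finset.sum_const, nsmul_eq_mul, mul_one]
      ring
    have h1 : sInf (φ '' feas) ≤ φ z' := csInf_le hbdd ⟨z', hz', rfl⟩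
    have h2 : ((S.biUnion t).card : ℝ) + 1 ≤ S.card := by exact_mod_cast hcard
    linarith
  obtain ⟨f, hf, hft⟩ := (Finset.all_card_le_biUnion_card_iff_exists_injective t).1 hall
  refine ⟨z.1, z.2, Equiv.ofBijective f (Finite.injective_iff_bijective.1 hf), hz, fun j => ?_⟩
  simpa [t] using hft j

lemma exists_mul_assignment_dual {ι : Type*} [Fintype ι] [Nonempty ι] (F : ι → ι → ℝ)
    (hF : ∀ j m, 0 < F j m) :
    ∃ (a b : ι → ℝ) (σ : Equiv.Perm ι), (∀ j, 0 < a j) ∧ (∀ m, 0 < b m) ∧ ∏ m, b m = 1 ∧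
      (∀ j m, F j m ≤ a j * b m) ∧
      ∏ j, a j ≤ Real.exp (Fintype.card ι) * ∏ j, F j (σ j) := by
  obtain ⟨a, u, σ, h1, h2⟩ := exists_assignment_dual fun j m => Real.log (F j m)
  have hN : (Fintype.card ι : ℝ) ≠ 0 := by exact_mod_cast Fintype.card_ne_zero
  -- Moving the mean of u into a leaves a + u unchanged and normalises ∏ b to 1.
  set v : ℝ := (∑ m, u m) / Fintype.card ι with hv
  refine ⟨fun j => Real.exp (a j + v), fun m => Real.exp (u m - v), σ, fun _ => Real.exp_pos _,
    fun _ => Real.exp_pos _, ?_, fun j m => ?_, ?_⟩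
  · rw [← Real.exp_sum, Finset.sum_sub_distrib, Finset.sum_const, Finset.card_univ, nsmul_eq_mul,
      hv, mul_div_cancel₀ _ hN, sub_self, Real.exp_zero]
  · rw [← Real.exp_add, ← Real.log_le_iff_le_exp (hF j m)]
    linarith [h1 j m]
  · have h3 : ∏ j, F j (σ j) = Real.exp (∑ j, Real.log (F j (σ j))) := by
      rw [Real.exp_sum]
      exact Finset.prod_congr rfl fun j _ => (Real.exp_log (hF _ _)).symm
    rw [h3, ← Real.exp_sum, ← Real.exp_add, Real.exp_le_exp]
    have h4 := Finset.sum_le_sum fun j (_ : j ∈ Finset.univ) => h2 j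
    rw [Finset.sum_sub_distrib, Finset.sum_add_distrib, Equiv.sum_comp σ u] at h4
    rw [Finset.sum_add_distrib, Finset.sum_const, Finset.card_univ, nsmul_eq_mul, hv,
      mul_div_cancel₀ _ hN]
    simp only [Finset.sum_const, Finset.card_univ, nsmul_eq_mul, mul_one] at h4
    linarith

/-- A product bound from weighted bounds for all weights of product one. -/
lemma prod_le_of_forall_weight {ι : Type*} [Fintype ι] [DecidableEq ι] [Nonempty ι]
    (F : ι → ι → ℝ≥0∞)
    (hF : ∀ j m, F j m ≠ ∞) (g : ι → ℝ≥0∞) {C : ℝ≥0∞} (hC : C ≠ ∞)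
    (h : ∀ b : ι → ℝ, (∀ m, 0 < b m) → ∏ m, b m = 1 → ∀ F' : ι → ι → ℝ≥0∞,
      (∀ j m, F j m < F' j m) → ∀ j, g j ≤ C * ∑ m, ENNReal.ofReal (b m)⁻¹ * F' j m)
    {I : ℝ≥0∞} (hI : ∀ σ : Equiv.Perm ι, ∏ j, F j (σ j) ≤ I) :
    ∏ j, g j ≤ ENNReal.ofReal (Real.exp (Fintype.card ι)) * (C * Fintype.card ι) ^ Fintype.card ι *
      (Fintype.card (Equiv.Perm ι) * I) := by
  set K : ℝ≥0∞ := ENNReal.ofReal (Real.exp (Fintype.card ι)) *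
    (C * Fintype.card ι) ^ Fintype.card ι with hK
  -- Adding ε makes the entries positive, as logarithms require, and strictly above F, as `h`
  -- requires since infima need not be attained. The optimal σ depends on ε, hence the sum over all
  -- permutations before ε → 0.
  have hε : ∀ ε : ℝ, 0 < ε → ∏ j, g j ≤
      K * ∑ σ : Equiv.Perm ι, ∏ j, (F j (σ j) + ENNReal.ofReal ε) := by
    intro ε hε
    have hpos : ∀ j m, 0 < (F j m).toReal + ε := fun j m =>
      add_pos_of_nonneg_of_pos ENNReal.toReal_nonneg hε
    have hFe : ∀ j m, ENNReal.ofReal ((F j m).toReal + ε) = F j m + ENNReal.ofReal ε :=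
      fun j m => by
        rw [ENNReal.ofReal_add ENNReal.toReal_nonneg hε.le, ENNReal.ofReal_toReal (hF j m)]
    obtain ⟨a, b, σ, ha, hb, hb1, hab, hprod⟩ := exists_mul_assignment_dual _ hpos
    have hg : ∀ j, g j ≤ C * Fintype.card ι * ENNReal.ofReal (a j) := by
      intro j
      refine (h b hb hb1 (fun j m => F j m + ENNReal.ofReal ε) (fun j m =>
        ENNReal.lt_add_right (hF j m) (ENNReal.ofReal_pos.2 hε).ne') j).trans ?_
      rw [mul_assoc]
      gcongr
      calc _ ≤ ∑ _m : ι, ENNReal.ofReal (a j) := by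
            refine Finset.sum_le_sum fun m _ => ?_
            rw [← hFe, ← ENNReal.ofReal_mul (inv_pos.2 (hb m)).le]
            refine ENNReal.ofReal_le_ofReal ?_
            rw [inv_mul_le_iff₀ (hb m), mul_comm]
            exact hab j m
        _ = _ := by simp
    calc ∏ j, g j ≤ ∏ j, (C * Fintype.card ι * ENNReal.ofReal (a j)) :=
          Finset.prod_le_prod' fun j _ => hg j
      _ = (C * Fintype.card ι) ^ Fintype.card ι * ENNReal.ofReal (∏ j, a j) := by
          rw [Finset.prod_mul_distrib, Finset.prod_const, Finset.card_univ,
            ENNReal.ofReal_prod_of_nonneg fun j _ => (ha j).le]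
      _ ≤ (C * Fintype.card ι) ^ Fintype.card ι * (ENNReal.ofReal (Real.exp (Fintype.card ι)) *
            ∏ j, (F j (σ j) + ENNReal.ofReal ε)) := by
          gcongr
          refine (ENNReal.ofReal_le_ofReal hprod).trans_eq ?_
          rw [ENNReal.ofReal_mul (Real.exp_pos _).le,
            ENNReal.ofReal_prod_of_nonneg fun j _ => (hpos _ _).le]
          simp only [hFe]
      _ = K * ∏ j, (F j (σ j) + ENNReal.ofReal ε) := by rw [hK]; ring
      _ ≤ _ := by
          gcongr
          exact Finset.single_le_sum
            (f := fun σ : Equiv.Perm ι => ∏ j, (F j (σ j) + ENNReal.ofReal ε))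
            (fun _ _ => zero_le) (Finset.mem_univ σ)
  have hKt : K ≠ ∞ := ENNReal.mul_ne_top ENNReal.ofReal_ne_top
    (ENNReal.pow_ne_top (ENNReal.mul_ne_top hC (ENNReal.natCast_ne_top _)))
  have hlim : Filter.Tendsto
      (fun ε : ℝ => K * ∑ σ : Equiv.Perm ι, ∏ j, (F j (σ j) + ENNReal.ofReal ε))
      (nhdsWithin 0 (Set.Ioi 0)) (nhds (K * ∑ σ : Equiv.Perm ι, ∏ j, F j (σ j))) := by
    refine ENNReal.Tendsto.const_mul ?_ (Or.inr hKt)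
    refine tendsto_finsetSum _ fun σ _ => ?_
    have hc : Filter.Tendsto (fun ε : ℝ => ENNReal.ofReal ε) (nhdsWithin 0 (Set.Ioi 0))
        (nhds 0) := by
      have := (ENNReal.continuous_ofReal.tendsto 0).mono_left (nhdsWithin_le_nhds (s := Set.Ioi 0))
      simpa using this
    refine ENNReal.tendsto_finsetProd_of_ne_top _ (fun j _ => ?_) fun j _ => hF j _
    simpa using tendsto_const_nhds.add hc
  refine (ge_of_tendsto hlim (eventually_mem_nhdsWithin.mono fun ε h => hε ε h)).trans ?_
  gcongr
  refine (Finset.sum_le_card_nsmul _ _ I fun σ _ => hI σ).trans_eq ?_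
  rw [nsmul_eq_mul, Finset.card_univ]

/-! ### Lower bounds for determinant integrals -/

/-- The least integral of `|P| * g` over the functions `P` with leading term `x ^ β`. -/
noncomputable def leadingInf {n : ℕ} (β : Fin n → ℕ) (g : (Fin n → ℝ) → ℝ≥0∞) : ℝ≥0∞ :=
  ⨅ (P : (Fin n → ℝ) → ℝ) (_ : HasLeadingTerm β 1 P), ∫⁻ x, ENNReal.ofReal |P x| * g x

lemma HasLeadingTerm.mul_leadingInf_le {n : ℕ} {β : Fin n → ℕ} {c : ℝ} {P : (Fin n → ℝ) → ℝ}
    (h : HasLeadingTerm β c P) (g : (Fin n → ℝ) → ℝ≥0∞) :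
    ENNReal.ofReal |c| * leadingInf β g ≤ ∫⁻ x, ENNReal.ofReal |P x| * g x := by
  rcases eq_or_ne c 0 with rfl | hc
  · simp
  have h' : HasLeadingTerm β 1 fun x => c⁻¹ * P x := by
    simpa [inv_mul_cancel₀ hc] using h.const_mul c⁻¹
  calc ENNReal.ofReal |c| * leadingInf β g
      ≤ ENNReal.ofReal |c| * ∫⁻ x, ENNReal.ofReal |c⁻¹ * P x| * g x := by
        gcongr
        exact iInf₂_le _ h'
    _ = ∫⁻ x, ENNReal.ofReal |P x| * g x := by
        rw [← lintegral_const_mul' _ _ ENNReal.ofReal_ne_top]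
        refine lintegral_congr fun x => ?_
        rw [← mul_assoc, ← ENNReal.ofReal_mul (abs_nonneg _), ← abs_mul, mul_inv_cancel_left₀ hc]

/-- The product of the generalized Vandermonde determinants with exponents `e k`. -/
noncomputable def detProd {n n' r : ℕ} (e : Fin n' → Fin r → Fin n → ℕ)
    (x : Fin r → Fin n → ℝ) : ℝ :=
  ∏ k, (Matrix.of fun j m : Fin r => ∏ i, x j i ^ e k m i).det

lemma measurable_detProd {n n' r : ℕ} (e : Fin n' → Fin r → Fin n → ℕ) :
    Measurable (detProd e) := by
  unfold detProd
  simp only [Matrix.det_apply]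
  fun_prop

/-- Expand each determinant along its last row: the cofactors do not involve y, and the largest
exponent sits in the last column, with cofactor sign +1. -/
lemma hasLeadingTerm_detProd {n n' r : ℕ} (e : Fin n' → Fin (r + 1) → Fin n → ℕ)
    (he : ∀ k, StrictMono fun m => toLex (e k m)) (x : Fin r → Fin n → ℝ) :
    HasLeadingTerm (∑ k, e k (Fin.last r)) (detProd (fun k m => e k m.castSucc) x)
      (fun y => detProd e (Fin.insertNth (Fin.last r) y x)) := by
  refine HasLeadingTerm.prod _ fun k _ => ?_
  let B : Fin (r + 1) → ℝ := fun m => (-1) ^ (r + (m : ℕ)) *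
    (Matrix.of fun j l : Fin r => ∏ i, x j i ^ e k (m.succAbove l) i).det
  have h : ∀ m ∈ Finset.univ, HasLeadingTerm (e k (Fin.last r))
      (B m * if m = Fin.last r then 1 else 0) (fun y => B m * ∏ i, y i ^ e k m i) := by
    intro m _
    refine HasLeadingTerm.const_mul ?_ _
    split_ifs with hm
    · rw [hm]; exact HasLeadingTerm.monomial _
    · exact HasLeadingTerm.monomial_of_lt (he k (Fin.lt_last_iff_ne_last.2 hm))
  have h' := HasLeadingTerm.sum _ h
  have e1 : ∑ m, B m * (if m = Fin.last r then 1 else 0) =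
      (Matrix.of fun j m : Fin r => ∏ i, x j i ^ e k m.castSucc i).det := by
    simp [B, ← two_mul, pow_mul]
  rw [e1] at h'
  convert! h' using 2 with y
  rw [Matrix.det_succ_row _ (Fin.last r)]
  refine Finset.sum_congr rfl fun m _ => ?_
  have e2 : ((Matrix.of fun j m : Fin (r + 1) =>
      ∏ i, (Fin.insertNth (Fin.last r) y x : Fin (r + 1) → Fin n → ℝ) j i ^ e k m i).submatrix
        (Fin.last r).succAbove m.succAbove) =
      Matrix.of fun j l : Fin r => ∏ i, x j i ^ e k (m.succAbove l) i := by
    ext j l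
    simp only [Matrix.submatrix_apply, Matrix.of_apply, Fin.insertNth_apply_succAbove]
  rw [e2]
  simp only [B, Matrix.of_apply, Fin.insertNth_apply_same, Fin.val_last]
  ring

/-- Integrating out the last point first costs a factor `leadingInf` and leaves the smaller
determinants, so induction on the number of points applies. -/
lemma prod_leadingInf_le_lintegral {n n' r : ℕ} (e : Fin n' → Fin r → Fin n → ℕ)
    (he : ∀ k, StrictMono fun m => toLex (e k m)) (g : Fin r → (Fin n → ℝ) → ℝ≥0∞)
    (hg : ∀ j, Measurable (g j)) :
    ∏ m, leadingInf (∑ k, e k m) (g m) ≤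
      ∫⁻ x : Fin r → Fin n → ℝ, ENNReal.ofReal |detProd e x| * ∏ j, g j (x j) := by
  induction r with
  | zero => simp [detProd, volume_pi]
  | succ r ih =>
    have hmeas : ∀ {q : ℕ} (e : Fin n' → Fin q → Fin n → ℕ) (g : Fin q → (Fin n → ℝ) → ℝ≥0∞),
        (∀ j, Measurable (g j)) → Measurable fun x : Fin q → Fin n → ℝ =>
          ENNReal.ofReal |detProd e x| * ∏ j, g j (x j) := fun e g hg =>
      (measurable_detProd e).abs.ennreal_ofReal.mul
        (Finset.measurable_fun_prod _ fun j _ => (hg j).comp (measurable_pi_apply j))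
    have hm := hmeas e g hg
    rw [lintegral_insertNth (Fin.last r) hm, lintegral_lintegral_swap, Fin.prod_univ_castSucc]
    swap
    · exact (hm.comp (measurable_insertNth (Fin.last r))).aemeasurable
    have ih' := ih (fun k m => e k m.castSucc)
      (fun k => (he k).comp Fin.strictMono_castSucc) (fun j => g j.castSucc) fun j => hg _
    refine (mul_le_mul_left ih' _).trans ?_
    rw [← lintegral_mul_const _ (hmeas _ _ fun j => hg _)]
    refine lintegral_mono fun x => ?_
    have h1 := (hasLeadingTerm_detProd e he x).mul_leadingInf_le (g (Fin.last r))
    calc _ = (ENNReal.ofReal |detProd (fun k m => e k m.castSucc) x| *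
          leadingInf (∑ k, e k (Fin.last r)) (g (Fin.last r))) * ∏ j, g j.castSucc (x j) := by
          ring
      _ ≤ (∫⁻ y, ENNReal.ofReal |detProd e (Fin.insertNth (Fin.last r) y x)| *
            g (Fin.last r) y) * ∏ j, g j.castSucc (x j) := by gcongr
      _ = ∫⁻ y, ENNReal.ofReal |detProd e (Fin.insertNth (Fin.last r) y x)| *
            g (Fin.last r) y * ∏ j, g j.castSucc (x j) := by
          refine (lintegral_mul_const _ (Measurable.mul ?_ (hg _))).symm
          exact (hasLeadingTerm_detProd e he x).measurable.abs.ennreal_ofReal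
      _ = _ := by
          refine lintegral_congr fun y => ?_
          rw [Fin.prod_univ_castSucc, Fin.insertNth_apply_same]
          simp only [Fin.insertNth_last', Fin.snoc_castSucc]
          ring

lemma abs_detProd_comp_perm {n n' r : ℕ} (e : Fin n' → Fin r → Fin n → ℕ)
    (σ : Equiv.Perm (Fin r)) (x : Fin r → Fin n → ℝ) :
    |detProd e fun j => x (σ j)| = |detProd e x| := by
  simp only [detProd, Finset.abs_prod]
  refine Finset.prod_congr rfl fun k _ => ?_
  have := Matrix.det_permute σ (Matrix.of fun j m : Fin r => ∏ i, x j i ^ e k m i)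
  have e1 : (Matrix.of fun j m : Fin r => ∏ i, x j i ^ e k m i).submatrix σ id =
    Matrix.of fun j m : Fin r => ∏ i, x (σ j) i ^ e k m i := rfl
  rw [← e1, this, abs_mul]
  rcases Int.units_eq_one_or (Equiv.Perm.sign σ) with h | h <;> simp [h]

lemma prod_leadingInf_perm_le_lintegral {n n' r : ℕ} (e : Fin n' → Fin r → Fin n → ℕ)
    (he : ∀ k, StrictMono fun m => toLex (e k m)) (g : Fin r → (Fin n → ℝ) → ℝ≥0∞)
    (hg : ∀ j, Measurable (g j)) (σ : Equiv.Perm (Fin r)) :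
    ∏ j, leadingInf (∑ k, e k (σ j)) (g j) ≤
      ∫⁻ x : Fin r → Fin n → ℝ, ENNReal.ofReal |detProd e x| * ∏ j, g j (x j) := by
  have h := prod_leadingInf_le_lintegral e he (fun m => g (σ.symm m)) fun m => hg _
  rw [← Equiv.prod_comp σ] at h
  simp only [Equiv.symm_apply_apply] at h
  refine h.trans_eq ?_
  have mp := volume_measurePreserving_piCongrLeft (fun _ : Fin r => Fin n → ℝ) σ
  rw [← mp.lintegral_comp_emb (MeasurableEquiv.measurableEmbedding _)]
  refine lintegral_congr fun x => ?_
  have hx : (MeasurableEquiv.piCongrLeft (fun _ : Fin r => Fin n → ℝ) σ) x =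
      fun j => x (σ.symm j) := by
    ext j
    obtain ⟨j, rfl⟩ := σ.surjective j
    rw [MeasurableEquiv.coe_piCongrLeft, Equiv.piCongrLeft_apply_apply]; simp
  rw [hx, abs_detProd_comp_perm e σ.symm x, Equiv.prod_comp σ.symm fun j => g j (x j)]

/-! ### Truncation and the inequality for nonnegative functions -/

lemma tendsto_finsetProd_of_ne_zero {ι κ : Type*} {l : Filter κ} (S : Finset ι)
    {f : ι → κ → ℝ≥0∞} {a : ι → ℝ≥0∞} (hf : ∀ i ∈ S, Filter.Tendsto (f i) l (nhds (a i)))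
    (ha : ∀ i ∈ S, a i ≠ 0) :
    Filter.Tendsto (fun k => ∏ i ∈ S, f i k) l (nhds (∏ i ∈ S, a i)) := by
  classical
  induction S using Finset.induction_on with
  | empty => simpa using tendsto_const_nhds
  | insert i S hi ih =>
    simp only [Finset.prod_insert hi]
    refine ENNReal.Tendsto.mul (hf i (Finset.mem_insert_self _ _)) ?_
      (ih (fun j hj => hf j (Finset.mem_insert_of_mem hj))
        fun j hj => ha j (Finset.mem_insert_of_mem hj)) ?_
    · exact Or.inl (ha i (Finset.mem_insert_self _ _))
    · exact Or.inl (Finset.prod_ne_zero_iff.2 fun j hj => ha j (Finset.mem_insert_of_mem hj))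

/-- The truncation of `g` to the ball of radius `k` and to values at most `k`. -/
noncomputable def truncate {n : ℕ} (g : (Fin n → ℝ) → ℝ≥0∞) (k : ℕ) : (Fin n → ℝ) → ℝ≥0∞ :=
  (Metric.closedBall 0 k).indicator fun x => min (g x) k

lemma measurable_truncate {n : ℕ} {g : (Fin n → ℝ) → ℝ≥0∞} (hg : Measurable g) (k : ℕ) :
    Measurable (truncate g k) :=
  (hg.min measurable_const).indicator measurableSet_closedBall

lemma truncate_le {n : ℕ} (g : (Fin n → ℝ) → ℝ≥0∞) (k : ℕ) (x : Fin n → ℝ) :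
    truncate g k x ≤ g x :=
  (Set.indicator_le_self _ _ x).trans (min_le_left _ _)

lemma monotone_truncate {n : ℕ} (g : (Fin n → ℝ) → ℝ≥0∞) (x : Fin n → ℝ) :
    Monotone fun k => truncate g k x := by
  intro k l hkl
  have hkl' : (k : ℝ) ≤ l := by exact_mod_cast hkl
  refine Set.indicator_le_indicator_of_subset (Metric.closedBall_subset_closedBall hkl')
    (fun _ => zero_le) x |>.trans ?_
  refine Set.indicator_le_indicator (min_le_min le_rfl ?_)
  exact_mod_cast hkl

lemma tendsto_truncate {n : ℕ} {g : (Fin n → ℝ) → ℝ≥0∞} {x : Fin n → ℝ} (hx : g x ≠ ∞) :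
    Filter.Tendsto (fun k => truncate g k x) Filter.atTop (nhds (g x)) := by
  obtain ⟨k₀, hk₀⟩ := exists_nat_ge ‖x‖
  obtain ⟨k₁, hk₁⟩ := ENNReal.exists_nat_gt hx
  refine tendsto_const_nhds.congr' ?_
  filter_upwards [Filter.eventually_ge_atTop (max k₀ k₁)] with k hk
  have h0 : (k₀ : ℝ) ≤ k := by exact_mod_cast (le_max_left _ _).trans hk
  have h1 : (k₁ : ℝ≥0∞) ≤ k := by exact_mod_cast (le_max_right _ _).trans hk
  rw [truncate, Set.indicator_of_mem (by simpa using hk₀.trans h0),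
    min_eq_left (hk₁.le.trans h1)]

/-- The monomial itself is a competitor and is bounded on the ball. This finiteness is what the
duality argument needs. -/
lemma leadingInf_truncate_ne_top {n : ℕ} (β : Fin n → ℕ) (g : (Fin n → ℝ) → ℝ≥0∞) (k : ℕ) :
    leadingInf β (truncate g k) ≠ ∞ := by
  obtain ⟨M, hM⟩ := (isCompact_closedBall (0 : Fin n → ℝ) (k : ℝ)).exists_bound_of_continuousOn
    (f := fun x : Fin n → ℝ => ∏ i, x i ^ β i) (by fun_prop)
  refine ne_top_of_le_ne_top ?_ (iInf₂_le _ (HasLeadingTerm.monomial β))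
  refine ne_top_of_le_ne_top (b := ∫⁻ x, (Metric.closedBall (0 : Fin n → ℝ) k).indicator
    (fun _ => ENNReal.ofReal M * k) x) ?_ (lintegral_mono fun x => ?_)
  · rw [lintegral_indicator_const measurableSet_closedBall]
    exact ENNReal.mul_ne_top (ENNReal.mul_ne_top ENNReal.ofReal_ne_top (ENNReal.natCast_ne_top _))
      (isCompact_closedBall _ _).measure_lt_top.ne
  · by_cases hx : x ∈ Metric.closedBall (0 : Fin n → ℝ) (k : ℝ)
    · rw [truncate, Set.indicator_of_mem hx, Set.indicator_of_mem hx]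
      exact mul_le_mul' (ENNReal.ofReal_le_ofReal (hM x hx)) (min_le_right _ _)
    · simp [truncate, Set.indicator_of_notMem hx]

theorem exists_prod_lintegral_rpow_le {n n' N s : ℕ} (hn : 0 < n) (hs : 0 < s)
    (e : Fin n' → Fin N → Fin n → ℕ) (he : ∀ k, StrictMono fun m => toLex (e k m))
    (hsum : ∀ i, ∑ m, (∑ k, e k m) i = s)
    (hspan : Submodule.span ℝ (Set.range fun m (i : Fin n) => ((∑ k, e k m) i : ℝ)) = ⊤)
    {m₀ : Fin N} (h₀ : ∑ k, e k m₀ = 0) {p : ℝ} (hp : p = N / (N + s)) :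
    ∃ K : ℝ≥0∞, K ≠ ∞ ∧ ∀ g : Fin N → (Fin n → ℝ) → ℝ≥0∞, (∀ j, Measurable (g j)) →
      (∀ j x, g j x ≠ ∞) → ∏ j, (∫⁻ x, g j x ^ p) ^ (1 / p) ≤
        K * ∫⁻ x : Fin N → Fin n → ℝ, ENNReal.ofReal |detProd e x| * ∏ j, g j (x j) := by
  have : Nonempty (Fin N) := ⟨m₀⟩
  obtain ⟨C, hC, hle⟩ := exists_lintegral_rpow_le hn (fun m => ∑ k, e k m) hs hsum hspan h₀
    (p := p) (by simpa using hp)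
  have hp0 : 0 < p := by
    have : (0 : ℝ) < N := by exact_mod_cast Fin.pos m₀
    rw [hp]; positivity
  refine ⟨ENNReal.ofReal (Real.exp N) * (C * N) ^ N * (Fintype.card (Equiv.Perm (Fin N))), ?_,
    fun g hg hgt => ?_⟩
  · exact ENNReal.mul_ne_top (ENNReal.mul_ne_top ENNReal.ofReal_ne_top (ENNReal.pow_ne_top
      (ENNReal.mul_ne_top hC (ENNReal.natCast_ne_top _)))) (ENNReal.natCast_ne_top _)
  -- A vanishing norm is set aside because a product of limits in `ℝ≥0∞` may fail to converge at 0 ·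
  -- ∞.
  rcases em (∃ j, (∫⁻ x, g j x ^ p) ^ (1 / p) = 0) with ⟨j, hj⟩ | hne
  · rw [Finset.prod_eq_zero (Finset.mem_univ j) hj]; exact zero_le
  push Not at hne
  have hlim : Filter.Tendsto (fun k => ∏ j, (∫⁻ x, truncate (g j) k x ^ p) ^ (1 / p))
      Filter.atTop (nhds (∏ j, (∫⁻ x, g j x ^ p) ^ (1 / p))) := by
    refine tendsto_finsetProd_of_ne_zero _ (fun j _ => ?_) fun j _ => hne j
    refine Filter.Tendsto.ennrpow_const _ ?_
    refine lintegral_tendsto_of_tendsto_of_monotone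
      (fun k => ((measurable_truncate (hg j) k).pow_const p).aemeasurable) ?_ ?_
    · exact .of_forall fun x k l hkl => ENNReal.rpow_le_rpow (monotone_truncate _ x hkl) hp0.le
    · exact .of_forall fun x => (tendsto_truncate (hgt j x)).ennrpow_const p
  refine le_of_tendsto hlim (.of_forall fun k => ?_)
  have hgk : ∀ j, Measurable (truncate (g j) k) := fun j => measurable_truncate (hg j) k
  have key := prod_le_of_forall_weight
    (fun j m : Fin N => leadingInf (∑ l, e l m) (truncate (g j) k))
    (fun j m => leadingInf_truncate_ne_top _ _ _)
    (fun j => (∫⁻ x, truncate (g j) k x ^ p) ^ (1 / p)) hC ?_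
    (fun σ => prod_leadingInf_perm_le_lintegral e he _ hgk σ)
  · refine key.trans ?_
    simp only [Fintype.card_fin, mul_assoc]
    gcongr with x j
    exact truncate_le _ _ _
  · intro b hb hb1 F' hF' j
    have hex : ∀ m, ∃ P, HasLeadingTerm (∑ l, e l m) 1 P ∧
        ∫⁻ x, ENNReal.ofReal |P x| * truncate (g j) k x < F' j m := by
      intro m
      simpa only [leadingInf, iInf_lt_iff, exists_prop] using hF' j m
    choose P hP hlt using hex
    refine (hle b hb hb1 P hP _ (hgk j)).trans ?_
    gcongr with m
    exact (hlt m).le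

/-! ### Admissible collections and the main theorem -/

section

variable {n n' N s : ℕ} {A : Finset ((Fin n → ℕ) × Fin n')}

lemma strictMono_enum (h : ∀ k, (slice A k).card = N) (k : Fin n') :
    StrictMono fun m => toLex (enum h k m) :=
  ((slice A k).orderEmbOfFin (h k)).strictMono

lemma Admissible.sum_beta (hA : Admissible A N s) (i : Fin n) :
    ∑ m, beta hA.dimensionality m i = s := by
  refine Eq.trans ?_ (hA.scaling i)
  simp only [beta, Finset.sum_apply]
  rw [Finset.sum_comm]
  refine Finset.sum_congr rfl fun k _ => ?_
  conv_rhs => rw [← Finset.map_orderEmbOfFin_univ (slice A k) (hA.dimensionality k)]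
  rw [Finset.sum_map]
  rfl

lemma Admissible.beta_eq_zero (hA : Admissible A N s) (hN : 0 < N) :
    beta hA.dimensionality ⟨0, hN⟩ = 0 := by
  refine Finset.sum_eq_zero fun k _ => ?_
  have h0 : toLex (0 : Fin n → ℕ) ∈ Set.range ((slice A k).orderEmbOfFin (hA.dimensionality k)) := by
    rw [Finset.range_orderEmbOfFin]
    exact hA.nondegeneracy k
  obtain ⟨j, hj⟩ := h0
  have h1 : toLex (enum hA.dimensionality k ⟨0, hN⟩) ≤ toLex 0 := by
    rw [← hj]
    exact ((slice A k).orderEmbOfFin (hA.dimensionality k)).monotone (Nat.zero_le _)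
  have h2 : toLex 0 ≤ toLex (enum hA.dimensionality k ⟨0, hN⟩) :=
    Pi.toLex_monotone fun i => Nat.zero_le _
  exact toLex.injective (le_antisymm h1 h2)

lemma Admissible.pos (hA : Admissible A N s) (hn : 0 < n)
    (hS : StrongSpanning hA.dimensionality) : 0 < s := by
  rcases Nat.eq_zero_or_pos s with rfl | h
  · exfalso
    have hz : (fun (m : Fin N) (i : Fin n) => (beta hA.dimensionality m i : ℝ)) = fun _ => 0 := by
      ext m i
      have := (Finset.sum_eq_zero_iff.1 (hA.sum_beta i)) m (Finset.mem_univ m)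
      simp [this]
    have : Nonempty (Fin n) := ⟨⟨0, hn⟩⟩
    have hbot : Submodule.span ℝ (Set.range fun (m : Fin N) (i : Fin n) =>
        (beta hA.dimensionality m i : ℝ)) = ⊥ := by
      rw [hz, Submodule.span_eq_bot]
      rintro _ ⟨m, rfl⟩
      rfl
    exact bot_ne_top (hbot.symm.trans hS)
  · exact h

end

end VandermondeMeans

theorem mainTheorem3 {n n' d N s : ℕ} (hn : 0 < n) (hn' : 0 < n')
    (A : Finset ((Fin n → ℕ) × Fin n'))
    (hAd : ∀ a ∈ A, a.1 ∈ VandermondeMeans.multiindices n d)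
    (hA : VandermondeMeans.Admissible A N s)
    (hS : VandermondeMeans.StrongSpanning hA.dimensionality) :
    (N : ℝ) / (N + s) < 1 ∧
    ∃ c : ℝ, 0 < c ∧ ∀ f : Fin N → (Fin n → ℝ) → ℂ, (∀ j, AEMeasurable (f j) volume) →
      ENNReal.ofReal c * ∏ j, eLpNorm (f j) (ENNReal.ofReal ((N : ℝ) / (N + s))) volume ≤
        ∫⁻ x : Fin N → Fin n → ℝ,
          ENNReal.ofReal |VandermondeMeans.vandermonde hA.dimensionality x| *
            ∏ j, ‖f j (x j)‖ₑ := by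
  have hs := hA.pos hn hS
  have hN : 0 < N := by
    rw [← hA.dimensionality ⟨0, hn'⟩]
    exact Finset.card_pos.2 ⟨_, hA.nondegeneracy _⟩
  have hsR : (0 : ℝ) < s := by exact_mod_cast hs
  have hNR : (0 : ℝ) < N := by exact_mod_cast hN
  have hp0 : 0 < (N : ℝ) / (N + s) := by positivity
  refine ⟨by rw [div_lt_one (by positivity)]; linarith, ?_⟩
  obtain ⟨K, hK, hle⟩ := VandermondeMeans.exists_prod_lintegral_rpow_le hn hs
    (VandermondeMeans.enum hA.dimensionality)
    (VandermondeMeans.strictMono_enum hA.dimensionality) hA.sum_beta hS (hA.beta_eq_zero hN) rfl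
  have hK1 : 0 < K.toReal + 1 := add_pos_of_nonneg_of_pos ENNReal.toReal_nonneg one_pos
  -- The added 1 keeps the constant positive without having to know that K is nonzero.
  refine ⟨(K.toReal + 1)⁻¹, inv_pos.2 hK1, fun f hf => ?_⟩
  have hmain := hle (fun j x => ‖(hf j).mk (f j) x‖ₑ) (fun j => (hf j).measurable_mk.enorm)
    fun j x => enorm_ne_top
  have hL : ∀ j, eLpNorm (f j) (ENNReal.ofReal ((N : ℝ) / (N + s))) volume =
      (∫⁻ x, ‖(hf j).mk (f j) x‖ₑ ^ ((N : ℝ) / (N + s))) ^ (1 / ((N : ℝ) / (N + s))) := by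
    intro j
    rw [eLpNorm_congr_ae (hf j).ae_eq_mk, eLpNorm_eq_lintegral_rpow_enorm_toReal
      (ENNReal.ofReal_pos.2 hp0).ne' ENNReal.ofReal_ne_top, ENNReal.toReal_ofReal hp0.le]
  have hR : ∫⁻ x : Fin N → Fin n → ℝ,
      ENNReal.ofReal |VandermondeMeans.vandermonde hA.dimensionality x| * ∏ j, ‖f j (x j)‖ₑ =
      ∫⁻ x : Fin N → Fin n → ℝ,
      ENNReal.ofReal |VandermondeMeans.detProd (VandermondeMeans.enum hA.dimensionality) x| *
        ∏ j, ‖(hf j).mk (f j) (x j)‖ₑ := by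
    have hae : ∀ᵐ x : Fin N → Fin n → ℝ, ∀ j, f j (x j) = (hf j).mk (f j) (x j) :=
      ae_all_iff.2 fun j => (Measure.quasiMeasurePreserving_eval (fun _ : Fin N => volume) j).ae_eq_comp
      (hf j).ae_eq_mk
    refine lintegral_congr_ae ?_
    filter_upwards [hae] with x hx
    simp only [hx]
    rfl
  simp only [hL]
  rw [hR]
  calc _ ≤ ENNReal.ofReal (K.toReal + 1)⁻¹ * (ENNReal.ofReal (K.toReal + 1) * _) := by
        gcongr
        refine hmain.trans (mul_le_mul_left ?_ _)
        rw [ENNReal.le_ofReal_iff_toReal_le hK hK1.le]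
        linarith
    _ = _ := by
        rw [← mul_assoc, ← ENNReal.ofReal_mul (inv_pos.2 hK1).le, inv_mul_cancel₀ hK1.ne',
          ENNReal.ofReal_one, one_mul]
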